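/- Let $I$ and $\mathcal{A}(I)$ be one of the following: (1) $I\subset\mathbb{R}$ is a nonempty open interval and $\mathcal{A}(I)=C^\infty(I,\mathbb{R})[D]$ with $D=\frac{d}{dt}$; (2) $I\subset\mathbb{C}$ is a non-compact, simply connected (embedded, smooth) real one-dimensional submanifold and $\mathcal{A}(I)=C^\infty(I,\mathbb{C})[D]$ with $D=\frac{d}{dz}$ the derivative with respect to $z$ along $I$; (3) $I\subset\mathbb{C}$ is a nonempty open connected set and $\mathcal{A}(I)=\mathcal{O}(I)[D]$, with $\mathcal{O}(I)$ the holomorphic functions on $I$ and $D=\frac{d}{dz}$. Here $\mathcal{A}(I)$ is the algebra of the linear differential operators $P=\alpha_mD^m+\dots+\alpha_0$ with coefficients in the stated function algebra, over $\mathbb{K}=\mathbb{R}$ in case (1) and $\mathbb{K}=\mathbb{C}$ in cases (2) and (3); the order of $P\neq 0$ is the largest $m$ with $\alpha_m\not\equiv 0$. Let $\mathcal{R}$ be the set of all commutative (unital) $\mathbb{K}$-subalgebras $A\subset\mathcal{A}(I)$ of rank $1$, i.e. which contain two operators of coprime orders, and whose elements are all in standard form, i.e. have constant highest and second highest coefficients.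 For a subalgebra $A$ let $C(A)=\{P\in\mathcal{A}(I)\mid PQ=QP\text{ for all }Q\in A\}$ be its centraliser. Then for every $A\in\mathcal{R}$ we have $C(A)\in\mathcal{R}$ (in particular, $C(A)$ is commutative), and $A\subset C(A)$ has finite codimension over $\mathbb{K}$ in $C(A)$. -/

import Mathlib

open scoped ContDiff

/-! ### Differential operators over a differential algebra -/

section Operators

variable {𝕜 F : Type*} [CommRing 𝕜] [CommRing F] [Algebra 𝕜 F]

/-- The operator `∑ i, αᵢ Dⁱ` on `F` which is written down by the polynomial `∑ i, αᵢ Xⁱ`. -/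
noncomputable def polyOp (D : Derivation 𝕜 F F) (p : Polynomial F) : Module.End 𝕜 F :=
  p.sum fun i α => LinearMap.mulLeft 𝕜 α * (D : Module.End 𝕜 F) ^ i

theorem polyOp_monomial (D : Derivation 𝕜 F F) (i : ℕ) (α : F) :
    polyOp D (Polynomial.monomial i α) =
      LinearMap.mulLeft 𝕜 α * (D : Module.End 𝕜 F) ^ i := by
  unfold polyOp
  rw [Polynomial.sum_monomial_index]
  simp

theorem polyOp_add (D : Derivation 𝕜 F F) (p q : Polynomial F) :
    polyOp D (p + q) = polyOp D p + polyOp D q := by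
  unfold polyOp
  refine Polynomial.sum_add_index p q _ (fun i => by simp) (fun i a b => ?_)
  ext f
  simp [add_mul]

theorem polyOp_mulLeft_mul (D : Derivation 𝕜 F F) (α : F) (q : Polynomial F) :
    ∃ r, polyOp D r = LinearMap.mulLeft 𝕜 α * polyOp D q := by
  induction q using Polynomial.induction_on' with
  | add p q hp hq =>
    obtain ⟨r, hr⟩ := hp
    obtain ⟨s, hs⟩ := hq
    exact ⟨r + s, by rw [polyOp_add, polyOp_add, hr, hs, mul_add]⟩
  | monomial n β =>
    refine ⟨Polynomial.monomial n (α * β), ?_⟩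
    rw [polyOp_monomial, polyOp_monomial]
    ext f
    simp

theorem polyOp_D_mul (D : Derivation 𝕜 F F) (q : Polynomial F) :
    ∃ r, polyOp D r = (D : Module.End 𝕜 F) * polyOp D q := by
  induction q using Polynomial.induction_on' with
  | add p q hp hq =>
    obtain ⟨r, hr⟩ := hp
    obtain ⟨s, hs⟩ := hq
    exact ⟨r + s, by rw [polyOp_add, polyOp_add, hr, hs, mul_add]⟩
  | monomial n β =>
    refine ⟨Polynomial.monomial (n + 1) β + Polynomial.monomial n (D β), ?_⟩
    rw [polyOp_add, polyOp_monomial, polyOp_monomial, polyOp_monomial]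
    ext f
    simp [pow_succ', mul_comm]

theorem polyOp_mul (D : Derivation 𝕜 F F) (p q : Polynomial F) :
    ∃ r, polyOp D r = polyOp D p * polyOp D q := by
  induction p using Polynomial.induction_on' with
  | add p p' hp hp' =>
    obtain ⟨r, hr⟩ := hp
    obtain ⟨s, hs⟩ := hp'
    exact ⟨r + s, by rw [polyOp_add, polyOp_add, hr, hs, add_mul]⟩
  | monomial n β =>
    have h : ∃ r, polyOp D r = (D : Module.End 𝕜 F) ^ n * polyOp D q := by
      induction n with
      | zero => exact ⟨q, by simp⟩
      | succ n ih =>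
        obtain ⟨r, hr⟩ := ih
        obtain ⟨s, hs⟩ := polyOp_D_mul D r
        exact ⟨s, by rw [hs, hr, pow_succ', mul_assoc]⟩
    obtain ⟨r, hr⟩ := h
    obtain ⟨s, hs⟩ := polyOp_mulLeft_mul D β r
    exact ⟨s, by rw [hs, hr, polyOp_monomial, mul_assoc]⟩

theorem polyOp_algebraMap (D : Derivation 𝕜 F F) (c : 𝕜) :
    polyOp D (Polynomial.C (algebraMap 𝕜 F c)) = algebraMap 𝕜 (Module.End 𝕜 F) c := by
  rw [← Polynomial.monomial_zero_left, polyOp_monomial]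
  ext f
  simp [Algebra.smul_def]

/-- The algebra `F[D]` of differential operators with coefficients in `F`, as a subalgebra of
the algebra of linear endomorphisms of `F`. -/
noncomputable def diffOps (D : Derivation 𝕜 F F) : Subalgebra 𝕜 (Module.End 𝕜 F) where
  carrier := Set.range (polyOp D)
  mul_mem' := by
    rintro _ _ ⟨p, rfl⟩ ⟨q, rfl⟩
    exact polyOp_mul D p q
  add_mem' := by
    rintro _ _ ⟨p, rfl⟩ ⟨q, rfl⟩
    exact ⟨p + q, polyOp_add D p q⟩
  algebraMap_mem' c := ⟨_, polyOp_algebraMap D c⟩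

/-- The type of differential operators with coefficients in `F`, an algebra over `𝕜`. -/
def DiffOp (D : Derivation 𝕜 F F) : Type _ := ↥(diffOps D)

noncomputable instance (D : Derivation 𝕜 F F) : Ring (DiffOp D) :=
  inferInstanceAs (Ring ↥(diffOps D))

noncomputable instance (D : Derivation 𝕜 F F) : Algebra 𝕜 (DiffOp D) :=
  inferInstanceAs (Algebra 𝕜 ↥(diffOps D))

/-- `P = αₘ Dᵐ + … + α₀` with `αₘ ≠ 0`, i.e. `P` is a (nonzero) operator of order `m`. -/
def HasOrder {D : Derivation 𝕜 F F} (P : DiffOp D) (m : ℕ) : Prop :=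
  ∃ p : Polynomial F, p ≠ 0 ∧ polyOp D p = P.1 ∧ p.natDegree = m

/-- The highest and the second highest coefficient of `P` are constant. (For an operator of
order `0`, the coefficient `p.nextCoeff` is `0`, so that there is no second condition.) -/
def IsStandardForm {D : Derivation 𝕜 F F} (P : DiffOp D) : Prop :=
  ∃ p : Polynomial F, polyOp D p = P.1 ∧
    (∃ c : 𝕜, p.leadingCoeff = algebraMap 𝕜 F c) ∧ (∃ c : 𝕜, p.nextCoeff = algebraMap 𝕜 F c)

/-- Commutative algebras of differential operators in standard form which are of rank `1`, that
is, which contain two operators of coprime orders. -/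
structure IsRankOne {D : Derivation 𝕜 F F} (A : Subalgebra 𝕜 (DiffOp D)) : Prop where
  commutative : ∀ P ∈ A, ∀ Q ∈ A, P * Q = Q * P
  standardForm : ∀ P ∈ A, IsStandardForm P
  coprime : ∃ P ∈ A, ∃ Q ∈ A, ∃ m n : ℕ, HasOrder P m ∧ HasOrder Q n ∧ Nat.Coprime m n

/-- The subalgebra `A` of `B` has finite codimension in `B`. -/
def FiniteCodimIn {R : Type*} [Ring R] [Algebra 𝕜 R] (A B : Subalgebra 𝕜 R) : Prop :=
  A ≤ B ∧ Module.Finite 𝕜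
    (↥(Subalgebra.toSubmodule B) ⧸
      (Subalgebra.toSubmodule A).submoduleOf (Subalgebra.toSubmodule B))

end Operators

/-! ### Coefficient functions on a domain `I`, and their derivation `d/dz` -/

section Functions

/-- Extension by zero of a function on `I`; it only serves to apply notions for functions on the
whole space, and only its values on `I` matter. -/
noncomputable def extZero {𝕜 : Type*} [Zero 𝕜] {I : Set 𝕜} (f : I → 𝕜) : 𝕜 → 𝕜 :=
  Function.extend Subtype.val f 0

theorem extZero_apply {𝕜 : Type*} [Zero 𝕜] {I : Set 𝕜} (f : I → 𝕜) {x : 𝕜} (hx : x ∈ I) :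
    extZero f x = f ⟨x, hx⟩ :=
  Subtype.val_injective.extend_apply f 0 (⟨x, hx⟩ : I)

/-- The type of the functions on `I` which belong to `F`, an algebra over `𝕜`. -/
def CoeffFun {𝕜 : Type*} [CommRing 𝕜] {I : Set 𝕜} (F : Subalgebra 𝕜 (I → 𝕜)) : Type _ := ↥F

noncomputable instance {𝕜 : Type*} [CommRing 𝕜] {I : Set 𝕜} (F : Subalgebra 𝕜 (I → 𝕜)) :
    CommRing (CoeffFun F) := inferInstanceAs (CommRing ↥F)

noncomputable instance {𝕜 : Type*} [CommRing 𝕜] {I : Set 𝕜} (F : Subalgebra 𝕜 (I → 𝕜)) :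
    Algebra 𝕜 (CoeffFun F) := inferInstanceAs (Algebra 𝕜 ↥F)

/-- The derivation `d/dz` of an algebra `F` of functions on `I`: the derivative of `f` at `z ∈ I`
is the limit of `(f w - f z) / (w - z)` for `w → z` in `I`. -/
noncomputable def derivOn {𝕜 : Type*} [NontriviallyNormedField 𝕜] {I : Set 𝕜}
    (F : Subalgebra 𝕜 (I → 𝕜)) (hu : UniqueDiffOn 𝕜 I)
    (hd : ∀ f ∈ F, DifferentiableOn 𝕜 (extZero f) I)
    (hF : ∀ f ∈ F, (fun z : I => derivWithin (extZero f) I z) ∈ F) :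
    Derivation 𝕜 (CoeffFun F) (CoeffFun F) :=
  Derivation.mk'
    { toFun := fun f => ⟨fun z => derivWithin (extZero f.1) I z, hF f.1 f.2⟩
      map_add' := fun f g => by
        refine Subtype.ext (funext fun z => ?_)
        have h : HasDerivWithinAt (extZero (f.1 + g.1)) _ I z :=
          ((hd f.1 f.2 z z.2).hasDerivWithinAt.add
            (hd g.1 g.2 z z.2).hasDerivWithinAt).congr
            (fun x hx => by simp [extZero_apply _ hx]) (by simp [extZero_apply _ z.2])
        exact h.derivWithin (hu z z.2)
      map_smul' := fun c f => by
        refine Subtype.ext (funext fun z => ?_)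
        have h : HasDerivWithinAt (extZero (c • f.1)) _ I z :=
          ((hd f.1 f.2 z z.2).hasDerivWithinAt.const_mul c).congr
            (fun x hx => by simp [extZero_apply _ hx]) (by simp [extZero_apply _ z.2])
        exact h.derivWithin (hu z z.2) }
    (fun f g => by
      refine Subtype.ext (funext fun z => ?_)
      have h : HasDerivWithinAt (extZero (f.1 * g.1)) _ I z :=
        ((hd f.1 f.2 z z.2).hasDerivWithinAt.mul
          (hd g.1 g.2 z z.2).hasDerivWithinAt).congr
          (fun x hx => by simp [extZero_apply _ hx]) (by simp [extZero_apply _ z.2])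
      refine (h.derivWithin (hu z z.2)).trans ?_
      show _ = f.1 z * derivWithin (extZero g.1) I z + g.1 z * derivWithin (extZero f.1) I z
      rw [extZero_apply _ z.2, extZero_apply _ z.2]
      ring)

/-- `C^∞(I, ℝ)`, the smooth real functions on (the open set) `I`. -/
noncomputable def realSmoothFun (I : Set ℝ) : Subalgebra ℝ (I → ℝ) where
  carrier := {f | ContDiffOn ℝ ∞ (extZero f) I}
  mul_mem' {f g} hf hg := (ContDiffOn.mul hf hg).congr
    fun x hx => by simp [extZero_apply _ hx]
  add_mem' {f g} hf hg := (ContDiffOn.add hf hg).congr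
    fun x hx => by simp [extZero_apply _ hx]
  algebraMap_mem' c := (contDiffOn_const (c := c)).congr
    fun x hx => by simp [extZero_apply _ hx]

/-- `C^∞(I, ℂ)`, the complex functions on `I` which are smooth in the real sense. -/
noncomputable def complexSmoothFun (I : Set ℂ) : Subalgebra ℂ (I → ℂ) where
  carrier := {f | ContDiffOn ℝ ∞ (extZero f) I}
  mul_mem' {f g} hf hg := (ContDiffOn.mul hf hg).congr
    fun x hx => by simp [extZero_apply _ hx]
  add_mem' {f g} hf hg := (ContDiffOn.add hf hg).congr
    fun x hx => by simp [extZero_apply _ hx]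
  algebraMap_mem' c := (contDiffOn_const (c := c)).congr
    fun x hx => by simp [extZero_apply _ hx]

/-- The algebra of holomorphic functions on (the open set) `I`. -/
noncomputable def holFun (I : Set ℂ) : Subalgebra ℂ (I → ℂ) where
  carrier := {f | DifferentiableOn ℂ (extZero f) I}
  mul_mem' {f g} hf hg := (DifferentiableOn.mul hf hg).congr
    fun x hx => by simp [extZero_apply _ hx]
  add_mem' {f g} hf hg := (DifferentiableOn.add hf hg).congr
    fun x hx => by simp [extZero_apply _ hx]
  algebraMap_mem' c := (differentiableOn_const c).congr
    fun x hx => by simp [extZero_apply _ hx]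

/-- Real one-dimensional (embedded, smooth) submanifolds of `ℂ = ℝ²`, through slice charts. -/
def IsSmoothCurve (I : Set ℂ) : Prop :=
  ∀ z ∈ I, ∃ Φ : OpenPartialHomeomorph ℂ ℂ, z ∈ Φ.source ∧
    ContDiffOn ℝ ∞ Φ Φ.source ∧ ContDiffOn ℝ ∞ Φ.symm Φ.target ∧
    ∀ w ∈ Φ.source, w ∈ I ↔ (Φ w).im = 0

/-- In a slice chart, a function on the curve which is smooth in the real sense has a derivative
with respect to `z` along the curve, which is again smooth. -/
theorem IsSmoothCurve.local_deriv {I : Set ℂ} {z : ℂ} (hz : z ∈ I)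
    (Φ : OpenPartialHomeomorph ℂ ℂ) (hzΦ : z ∈ Φ.source) (h1 : ContDiffOn ℝ ∞ Φ Φ.source)
    (h2 : ContDiffOn ℝ ∞ Φ.symm Φ.target) (h3 : ∀ w ∈ Φ.source, w ∈ I ↔ (Φ w).im = 0)
    {f : ℂ → ℂ} (hf : ContDiffOn ℝ ∞ f I) :
    UniqueDiffWithinAt ℂ I z ∧
    ∃ g : ℂ → ℂ, ContDiffOn ℝ ∞ g (I ∩ Φ.source) ∧
      ∀ w ∈ I ∩ Φ.source, HasDerivWithinAt f (g w) I w := by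
  set V : Set ℝ := {t | (t : ℂ) ∈ Φ.target} with hV
  have hVo : IsOpen V := Φ.open_target.preimage Complex.continuous_ofReal
  set γ : ℝ → ℂ := fun t => Φ.symm t with hγ
  set τ : ℂ → ℝ := fun w => (Φ w).re with hτ
  have hofReal : ContDiff ℝ ∞ (fun t : ℝ => (t : ℂ)) := Complex.ofRealCLM.contDiff
  have hγs : ContDiffOn ℝ ∞ γ V := h2.comp hofReal.contDiffOn (fun t ht => ht)
  have hτs : ContDiffOn ℝ ∞ τ Φ.source := Complex.reCLM.contDiff.comp_contDiffOn h1
  have hΦτ : ∀ w ∈ I ∩ Φ.source, ((τ w : ℝ) : ℂ) = Φ w := fun w hw =>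
    Complex.ext (by simp [hτ]) (by simp [(h3 w hw.2).1 hw.1])
  have hτV : ∀ w ∈ I ∩ Φ.source, τ w ∈ V := fun w hw => by
    show ((τ w : ℝ) : ℂ) ∈ Φ.target
    rw [hΦτ w hw]
    exact Φ.map_source hw.2
  have hγτ : ∀ w ∈ I ∩ Φ.source, γ (τ w) = w := fun w hw => by
    show Φ.symm ((τ w : ℝ) : ℂ) = w
    rw [hΦτ w hw]
    exact Φ.left_inv hw.2
  have hτγ : ∀ t ∈ V, τ (γ t) = t := fun t ht => by
    show (Φ (Φ.symm t)).re = t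
    rw [Φ.right_inv ht, Complex.ofReal_re]
  have hγI : ∀ t ∈ V, γ t ∈ I ∩ Φ.source := fun t ht => by
    have hs : γ t ∈ Φ.source := Φ.map_target ht
    refine ⟨(h3 _ hs).2 ?_, hs⟩
    show (Φ (Φ.symm t)).im = 0
    rw [Φ.right_inv ht, Complex.ofReal_im]
  have hne : (∞ : WithTop ℕ∞) ≠ 0 := by simp
  have hγd : ∀ t ∈ V, HasDerivAt γ (deriv γ t) t := fun t ht =>
    ((hγs.contDiffAt (hVo.mem_nhds ht)).differentiableAt hne).hasDerivAt
  have hτd : ∀ w ∈ Φ.source, HasFDerivAt τ (fderiv ℝ τ w) w := fun w hw =>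
    ((hτs.contDiffAt (Φ.open_source.mem_nhds hw)).differentiableAt hne).hasFDerivAt
  have hγ0 : ∀ t ∈ V, deriv γ t ≠ 0 := fun t ht h0 => by
    have hc := (hτd (γ t) (hγI t ht).2).comp_hasDerivAt t (hγd t ht)
    have hi : HasDerivAt (τ ∘ γ) 1 t :=
      (hasDerivAt_id t).congr_of_eventuallyEq
        (Filter.mem_of_superset (hVo.mem_nhds ht) fun s hs => hτγ s hs)
    have := hc.unique hi
    rw [h0, map_zero] at this
    exact zero_ne_one this
  have hfγ : ContDiffOn ℝ ∞ (f ∘ γ) V := hf.comp hγs fun t ht => (hγI t ht).1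
  have hfγd : ∀ t ∈ V, HasDerivAt (f ∘ γ) (deriv (f ∘ γ) t) t := fun t ht =>
    ((hfγ.contDiffAt (hVo.mem_nhds ht)).differentiableAt hne).hasDerivAt
  have hinf : (∞ : WithTop ℕ∞) + 1 ≤ ∞ := by norm_cast
  constructor
  · rw [uniqueDiffWithinAt_iff_accPt, accPt_iff_frequently]
    have hzi : z ∈ I ∩ Φ.source := ⟨hz, hzΦ⟩
    have hcont : ContinuousAt γ (τ z) := (hγd _ (hτV z hzi)).continuousAt
    have hten : Filter.Tendsto γ (nhdsWithin (τ z) {τ z}ᶜ) (nhds z) := by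
      have := hcont.tendsto
      rw [hγτ z hzi] at this
      exact this.mono_left nhdsWithin_le_nhds
    refine hten.frequently (Filter.Eventually.frequently ?_)
    have hVn : ∀ᶠ t in nhdsWithin (τ z) {τ z}ᶜ, t ∈ V :=
      nhdsWithin_le_nhds (hVo.mem_nhds (hτV z hzi))
    filter_upwards [hVn, self_mem_nhdsWithin] with t ht htn
    refine ⟨fun h => htn ?_, (hγI t ht).1⟩
    have := hτγ t ht
    rw [h] at this
    exact this.symm
  · refine ⟨fun w => deriv (f ∘ γ) (τ w) / deriv γ (τ w), ?_, ?_⟩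
    · have hτs' : ContDiffOn ℝ ∞ τ (I ∩ Φ.source) := hτs.mono Set.inter_subset_right
      have a1 : ContDiffOn ℝ ∞ (fun w => deriv (f ∘ γ) (τ w)) (I ∩ Φ.source) :=
        (hfγ.deriv_of_isOpen hVo hinf).comp hτs' hτV
      have a2 : ContDiffOn ℝ ∞ (fun w => deriv γ (τ w)) (I ∩ Φ.source) :=
        (hγs.deriv_of_isOpen hVo hinf).comp hτs' hτV
      have a3 := a1.mul (a2.inv fun w hw => hγ0 _ (hτV w hw))
      exact a3.congr fun w hw => by simp [div_eq_mul_inv]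
    · intro w hw
      have hev : ∀ᶠ v in nhdsWithin w I, v ∈ I ∩ Φ.source :=
        Filter.inter_mem self_mem_nhdsWithin
          (nhdsWithin_le_nhds (Φ.open_source.mem_nhds hw.2))
      have hτw := (hτd w hw.2).hasFDerivWithinAt (s := I)
      have b1 : HasFDerivWithinAt f
          ((fderiv ℝ τ w).smulRight (deriv (f ∘ γ) (τ w))) I w := by
        refine ((hfγd _ (hτV w hw)).hasFDerivAt.comp_hasFDerivWithinAt w hτw).congr_of_eventuallyEq ?_ ?_
        · filter_upwards [hev] with v hv
          simp [hγτ v hv]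
        · simp [hγτ w hw]
      have b2 : HasFDerivWithinAt (fun v : ℂ => v)
          ((fderiv ℝ τ w).smulRight (deriv γ (τ w))) I w := by
        refine ((hγd _ (hτV w hw)).hasFDerivAt.comp_hasFDerivWithinAt w hτw).congr_of_eventuallyEq ?_ ?_
        · filter_upwards [hev] with v hv
          simp [hγτ v hv]
        · simp [hγτ w hw]
      have c1 := b1.isLittleO
      have c2 := (b2.isLittleO).const_mul_left (deriv (f ∘ γ) (τ w) / deriv γ (τ w))
      rw [hasDerivWithinAt_iff_isLittleO]
      refine (c1.sub c2).congr_left fun v => ?_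
      have h0 := hγ0 _ (hτV w hw)
      simp only [ContinuousLinearMap.smulRight_apply, Complex.real_smul, smul_eq_mul]
      field_simp
      ring

theorem IsSmoothCurve.uniqueDiffOn {I : Set ℂ} (hI : IsSmoothCurve I) : UniqueDiffOn ℂ I := by
  intro z hz
  obtain ⟨Φ, hzΦ, h1, h2, h3⟩ := hI z hz
  exact (IsSmoothCurve.local_deriv hz Φ hzΦ h1 h2 h3 (contDiffOn_const (c := 0))).1

theorem IsSmoothCurve.differentiableOn {I : Set ℂ} (hI : IsSmoothCurve I) {f : ℂ → ℂ}
    (hf : ContDiffOn ℝ ∞ f I) : DifferentiableOn ℂ f I := by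
  intro z hz
  obtain ⟨Φ, hzΦ, h1, h2, h3⟩ := hI z hz
  obtain ⟨-, g, -, hg⟩ := IsSmoothCurve.local_deriv hz Φ hzΦ h1 h2 h3 hf
  exact (hg z ⟨hz, hzΦ⟩).differentiableWithinAt

theorem IsSmoothCurve.contDiffOn_derivWithin {I : Set ℂ} (hI : IsSmoothCurve I) {f : ℂ → ℂ}
    (hf : ContDiffOn ℝ ∞ f I) : ContDiffOn ℝ ∞ (derivWithin f I) I := by
  intro z hz
  obtain ⟨Φ, hzΦ, h1, h2, h3⟩ := hI z hz
  obtain ⟨-, g, hgs, hg⟩ := IsSmoothCurve.local_deriv hz Φ hzΦ h1 h2 h3 hf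
  have h : ContDiffOn ℝ ∞ (derivWithin f I) (I ∩ Φ.source) :=
    hgs.congr fun w hw => (hg w hw).derivWithin (hI.uniqueDiffOn w hw.1)
  exact (h z ⟨hz, hzΦ⟩).mono_of_mem_nhdsWithin
    (Filter.inter_mem self_mem_nhdsWithin
      (nhdsWithin_le_nhds (Φ.open_source.mem_nhds hzΦ)))

/-- `d/dt` on `C^∞(I, ℝ)`, for an open set `I` of real numbers. -/
noncomputable def derivReal {I : Set ℝ} (hI : IsOpen I) :
    Derivation ℝ (CoeffFun (realSmoothFun I)) (CoeffFun (realSmoothFun I)) :=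
  derivOn (realSmoothFun I) hI.uniqueDiffOn
    (fun _ hf => ContDiffOn.differentiableOn hf (by simp))
    (fun _ hf => ((contDiffOn_infty_iff_derivWithin hI.uniqueDiffOn).1 hf).2.congr
      fun _ hx => extZero_apply _ hx)

/-- `d/dz` on `C^∞(I, ℂ)`, for a real one-dimensional submanifold `I` of `ℂ`. -/
noncomputable def derivCurve {I : Set ℂ} (hI : IsSmoothCurve I) :
    Derivation ℂ (CoeffFun (complexSmoothFun I)) (CoeffFun (complexSmoothFun I)) :=
  derivOn (complexSmoothFun I) hI.uniqueDiffOn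
    (fun _ hf => hI.differentiableOn hf)
    (fun _ hf => (hI.contDiffOn_derivWithin hf).congr fun _ hx => extZero_apply _ hx)

/-- `d/dz` on the holomorphic functions on an open subset `I` of `ℂ`. -/
noncomputable def derivHol {I : Set ℂ} (hI : IsOpen I) :
    Derivation ℂ (CoeffFun (holFun I)) (CoeffFun (holFun I)) :=
  derivOn (holFun I) hI.uniqueDiffOn
    (fun _ hf => hf)
    (fun f hf => ((DifferentiableOn.deriv (f := extZero f) hf hI).congr
      fun _ hx => derivWithin_of_isOpen hI hx).congr fun _ hx => extZero_apply _ hx)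

end Functions

/-! ### Symbol calculus for `F[D]` -/

section Symbols

variable {𝕜 F : Type*} [CommRing 𝕜] [CommRing F] [Algebra 𝕜 F]

/-! The argument is algebraic (`isRankOne_centralizer`): it needs only characteristic zero, a
nonzero `F` with a coordinate `z`, `D z = 1`, and `ker D = 𝕜`. Smooth functions have zero divisors,
so orders in `F[D]` need not add; the proof works with operators whose leading coefficient is a
nonzero constant, where they do.

Standard form passes to the centraliser (`isStandardForm_of_commute`). Let `P` in `A` have order `m
> 0` and leading coefficient `c`, and let `Q` of order `k` commute with `P`. If `l` is the largest
index of a nonconstant coefficient of `Q` and `l ≥ k - 1`, the coefficient of `[P, Q]` at `D ^ (m +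
l - 1)` is `m c D(q_l)`, since the top two coefficients of `P` are constant. It is nonzero, a
contradiction.

Finite codimension (`finiteCodimIn_of_hasSymbol`): products of powers of two operators of coprime
orders realise all large orders, so subtracting elements of `A` reduces any element of the
centraliser to bounded order. Below the bound, one further operator per order suffices, because
leading coefficients lie in the field `𝕜`.

Commutativity (`FiniteCodimIn.commute`): for `x` in the centraliser and `R` in `A` of positive
order, finite codimension gives `f ≠ 0` with `f(R) x` in `A`. Hence `f(R) (x y - y x) = 0` for every
`y` in the centraliser, and leading coefficients permit cancelling `f(R)`. -/

/-- The derivation `D`, applied to the coefficients of a polynomial. -/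
noncomputable def coeffDeriv (D : Derivation 𝕜 F F) (p : Polynomial F) : Polynomial F :=
  PolynomialModule.equivPolynomialSelf (D.mapCoeffs p)

@[simp]
theorem coeff_coeffDeriv (D : Derivation 𝕜 F F) (p : Polynomial F) (n : ℕ) :
    (coeffDeriv D p).coeff n = D (p.coeff n) := rfl

@[simp]
theorem polyOp_zero (D : Derivation 𝕜 F F) : polyOp D 0 = 0 := by
  simp [polyOp]

theorem polyOp_neg (D : Derivation 𝕜 F F) (p : Polynomial F) : polyOp D (-p) = -polyOp D p := by
  rw [eq_neg_iff_add_eq_zero, ← polyOp_add, neg_add_cancel, polyOp_zero]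

theorem polyOp_sub (D : Derivation 𝕜 F F) (p q : Polynomial F) :
    polyOp D (p - q) = polyOp D p - polyOp D q := by
  rw [sub_eq_add_neg, polyOp_add, polyOp_neg, sub_eq_add_neg]

theorem polyOp_C_mul (D : Derivation 𝕜 F F) (α : F) (q : Polynomial F) :
    polyOp D (Polynomial.C α * q) = LinearMap.mulLeft 𝕜 α * polyOp D q := by
  induction q using Polynomial.induction_on' with
  | add p q hp hq => rw [mul_add, polyOp_add, polyOp_add, hp, hq, mul_add]
  | monomial n β =>
    rw [Polynomial.C_mul_monomial, polyOp_monomial, polyOp_monomial]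
    ext f
    simp

theorem polyOp_X_mul_add_coeffDeriv (D : Derivation 𝕜 F F) (q : Polynomial F) :
    polyOp D (Polynomial.X * q + coeffDeriv D q) = (D : Module.End 𝕜 F) * polyOp D q := by
  induction q using Polynomial.induction_on' with
  | add p q hp hq =>
    rw [polyOp_add _ p q, mul_add (D : Module.End 𝕜 F), ← hp, ← hq, ← polyOp_add]
    congr 1
    ext n
    simp only [mul_add, Polynomial.coeff_add, coeff_coeffDeriv, map_add]
    ring
  | monomial n β =>
    have h : coeffDeriv D (Polynomial.monomial n β) = Polynomial.monomial n (D β) := by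
      ext j
      rw [coeff_coeffDeriv, Polynomial.coeff_monomial, Polynomial.coeff_monomial]
      split_ifs <;> simp
    rw [h, Polynomial.X_mul_monomial, polyOp_add, polyOp_monomial, polyOp_monomial,
      polyOp_monomial]
    ext f
    simp [pow_succ', mul_comm]

/-- The Leibniz rule gives the terms `(n choose i) X ^ (n - i) D^i q`; those with `i ≥ 2` go into
`e`. Here `l` bounds the degree of `D q`, not of `q`: this sharper bound is what makes the
commutator computation work. Writing `j + 2` avoids truncated subtraction in "degree at most `n + l
- 2`". -/
theorem exists_polyOp_X_pow_mul (D : Derivation 𝕜 F F) (q : Polynomial F) (l : ℕ)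
    (hq : ∀ j, l < j → D (q.coeff j) = 0) (n : ℕ) :
    ∃ e : Polynomial F, (∀ j, n + l < j + 2 → e.coeff j = 0) ∧
      (D : Module.End 𝕜 F) ^ n * polyOp D q =
        polyOp D (Polynomial.X ^ n * q +
          Polynomial.derivative (Polynomial.X ^ n) * coeffDeriv D q + e) := by
  induction n with
  | zero => exact ⟨0, by simp, by simp⟩
  | succ n ih =>
    obtain ⟨e, he, h⟩ := ih
    have hX : ∀ r : Polynomial F, ∀ j, (Polynomial.X ^ n * r).coeff j =
        if n ≤ j then r.coeff (j - n) else 0 := fun r j => Polynomial.coeff_X_pow_mul' r n j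
    have hdX : ∀ r : Polynomial F, ∀ j,
        (Polynomial.derivative (Polynomial.X ^ n) * r).coeff j =
          if n ≤ j + 1 then n * r.coeff (j + 1 - n) else 0 := by
      intro r j
      rcases n with _ | n
      · simp
      · rw [Polynomial.derivative_X_pow, mul_assoc, Polynomial.coeff_C_mul,
          Nat.add_sub_cancel, Polynomial.coeff_X_pow_mul']
        simp
    refine ⟨Polynomial.X * e + coeffDeriv D e +
      Polynomial.derivative (Polynomial.X ^ n) * coeffDeriv D (coeffDeriv D q), ?_, ?_⟩
    · intro j hj
      have h1 : (Polynomial.X * e).coeff j = 0 := by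
        rcases j with _ | j
        · simp
        · rw [Polynomial.coeff_X_mul]
          exact he j (by omega)
      have h2 : (coeffDeriv D e).coeff j = 0 := by
        rw [coeff_coeffDeriv, he j (by omega), map_zero]
      rw [Polynomial.coeff_add, Polynomial.coeff_add, h1, h2, hdX]
      split_ifs with hn
      · simp [hq (j + 1 - n) (by omega)]
      · simp
    · rw [pow_succ', mul_assoc, h, ← polyOp_X_mul_add_coeffDeriv]
      congr 1
      ext j
      have hd : coeffDeriv D (Polynomial.X ^ n * q +
          Polynomial.derivative (Polynomial.X ^ n) * coeffDeriv D q + e) =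
          Polynomial.X ^ n * coeffDeriv D q +
          Polynomial.derivative (Polynomial.X ^ n) * coeffDeriv D (coeffDeriv D q) +
          coeffDeriv D e := by
        ext j
        simp only [Polynomial.coeff_add, coeff_coeffDeriv, map_add, hX, hdX]
        split_ifs <;> simp
      rw [hd]
      congr 1
      rw [pow_succ' Polynomial.X n, Polynomial.derivative_mul, Polynomial.derivative_X]
      ring

/-- The first two terms of the expansion of the symbol of a product. -/
theorem exists_polyOp_mul (D : Derivation 𝕜 F F) (p q : Polynomial F) (m l : ℕ)
    (hp : p.natDegree ≤ m) (hq : ∀ j, l < j → D (q.coeff j) = 0) :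
    ∃ e : Polynomial F, (∀ j, m + l < j + 2 → e.coeff j = 0) ∧
      polyOp D p * polyOp D q =
        polyOp D (p * q + Polynomial.derivative p * coeffDeriv D q + e) := by
  refine Polynomial.induction_with_natDegree_le (fun p => ∃ e : Polynomial F,
    (∀ j, m + l < j + 2 → e.coeff j = 0) ∧ polyOp D p * polyOp D q =
      polyOp D (p * q + Polynomial.derivative p * coeffDeriv D q + e)) m
    ⟨0, by simp, by simp⟩ ?_ ?_ p hp
  · intro n β _ hn
    obtain ⟨e, he, h⟩ := exists_polyOp_X_pow_mul D q l hq n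
    refine ⟨Polynomial.C β * e, fun j hj => ?_, ?_⟩
    · rw [Polynomial.coeff_C_mul, he j (by omega), mul_zero]
    · rw [Polynomial.C_mul_X_pow_eq_monomial, polyOp_monomial, mul_assoc, h, ← polyOp_C_mul,
        ← Polynomial.C_mul_X_pow_eq_monomial, Polynomial.derivative_C_mul]
      congr 1
      ring
  · rintro f g _ _ ⟨e, he, h⟩ ⟨e', he', h'⟩
    refine ⟨e + e', fun j hj => ?_, ?_⟩
    · rw [Polynomial.coeff_add, he j hj, he' j hj, add_zero]
    · rw [polyOp_add, add_mul, h, h', ← polyOp_add, Polynomial.derivative_add]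
      congr 1
      ring

theorem polyOp_apply_C (D : Derivation 𝕜 F F) (a f : F) :
    polyOp D (Polynomial.C a) f = a * f := by
  rw [← Polynomial.monomial_zero_left, polyOp_monomial]
  simp

/-- The commutator with the multiplication by a coordinate differentiates the symbol. -/
theorem polyOp_derivative (D : Derivation 𝕜 F F) {z : F} (hz : D z = 1) (p : Polynomial F) :
    polyOp D (Polynomial.derivative p) =
      polyOp D p * LinearMap.mulLeft 𝕜 z - LinearMap.mulLeft 𝕜 z * polyOp D p := by
  have key : ∀ p : Polynomial F, polyOp D p * LinearMap.mulLeft 𝕜 z =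
      polyOp D (Polynomial.C z * p + Polynomial.derivative p) := by
    intro p
    induction p using Polynomial.induction_on' with
    | add p q hp hq =>
      rw [polyOp_add, add_mul, hp, hq, ← polyOp_add, Polynomial.derivative_add]
      congr 1
      ring
    | monomial n β =>
      have hn : ∀ n : ℕ, (D : Module.End 𝕜 F) ^ n * LinearMap.mulLeft 𝕜 z =
          LinearMap.mulLeft 𝕜 z * (D : Module.End 𝕜 F) ^ n +
            (n : Module.End 𝕜 F) * (D : Module.End 𝕜 F) ^ (n - 1) := by
        intro n
        have hD : (D : Module.End 𝕜 F) * LinearMap.mulLeft 𝕜 z =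
            LinearMap.mulLeft 𝕜 z * (D : Module.End 𝕜 F) + 1 := by
          ext f; simp [hz]
        induction n with
        | zero => simp
        | succ n ih =>
          rw [pow_succ', mul_assoc, ih, mul_add, ← mul_assoc, hD, ← mul_assoc,
            ← Nat.cast_comm, mul_assoc _ (D : Module.End 𝕜 F)]
          rcases n with _ | n
          · simp
          · rw [Nat.add_sub_cancel, Nat.add_sub_cancel, ← pow_succ', ← pow_succ', add_mul,
              one_mul, mul_assoc, ← pow_succ']
            push_cast
            rw [add_mul ((n : Module.End 𝕜 F) + 1) 1, one_mul]
            abel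
      rw [polyOp_monomial, mul_assoc, hn, Polynomial.derivative_monomial, polyOp_add,
        polyOp_C_mul, polyOp_monomial, polyOp_monomial]
      ext f
      simp
      ring
  rw [key, polyOp_add, polyOp_C_mul, add_sub_cancel_left]

/-- The kernel is stable under differentiating symbols, by commutation with `z`. Induction on the
degree therefore gives `p' = 0`, torsion-freeness makes `p` a constant, and evaluation at `1` shows
that it vanishes. -/
theorem polyOp_injective [IsAddTorsionFree F] (D : Derivation 𝕜 F F) {z : F} (hz : D z = 1) :
    Function.Injective (polyOp D) := by
  have key : ∀ n : ℕ, ∀ p : Polynomial F, p.natDegree ≤ n → polyOp D p = 0 → p = 0 := by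
    intro n
    induction n with
    | zero =>
      intro p hp h
      rw [Polynomial.eq_C_of_natDegree_le_zero hp] at h ⊢
      have := polyOp_apply_C D (p.coeff 0) 1
      rw [h] at this
      simpa using this.symm
    | succ n ih =>
      intro p hp h
      have hd := ih (Polynomial.derivative p) (by rw [Polynomial.natDegree_derivative]; omega)
        (by rw [polyOp_derivative D hz, h]; simp)
      exact ih p (by rw [Polynomial.derivative_eq_zero.1 hd]; omega) h
  intro p q h
  exact sub_eq_zero.1 (key _ _ le_rfl (by rw [polyOp_sub, h, sub_self]))

end Symbols

/-! ### Constant leading symbols, and standard form of commuting operators -/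

section Centralizer

variable {𝕜 F : Type*} [Field 𝕜] [CommRing F] [Algebra 𝕜 F]

/-- `P` has order at most `m`, and the constant `c` as its coefficient at `Dᵐ`. -/
def HasSymbol {D : Derivation 𝕜 F F} (P : DiffOp D) (m : ℕ) (c : 𝕜) : Prop :=
  ∃ p : Polynomial F, polyOp D p = P.1 ∧ p.natDegree ≤ m ∧ p.coeff m = algebraMap 𝕜 F c

variable {D : Derivation 𝕜 F F}

theorem hasSymbol_algebraMap (c : 𝕜) : HasSymbol (algebraMap 𝕜 (DiffOp D) c) 0 c :=
  ⟨Polynomial.C (algebraMap 𝕜 F c), polyOp_algebraMap D c, by simp, by simp⟩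

theorem HasSymbol.of_lt {P : DiffOp D} {m n : ℕ} {c : 𝕜} (h : HasSymbol P m c) (hmn : m < n) :
    HasSymbol P n 0 := by
  obtain ⟨p, hp, hd, -⟩ := h
  exact ⟨p, hp, by omega, by rw [Polynomial.coeff_eq_zero_of_natDegree_lt (by omega), map_zero]⟩

theorem HasSymbol.add {P Q : DiffOp D} {m : ℕ} {c d : 𝕜} (hP : HasSymbol P m c)
    (hQ : HasSymbol Q m d) : HasSymbol (P + Q) m (c + d) := by
  obtain ⟨p, hp, hpd, hpc⟩ := hP
  obtain ⟨q, hq, hqd, hqc⟩ := hQ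
  refine ⟨p + q, ?_, Polynomial.natDegree_add_le_of_degree_le hpd hqd, ?_⟩
  · rw [polyOp_add, hp, hq]; rfl
  · rw [Polynomial.coeff_add, hpc, hqc, map_add]

theorem HasSymbol.mul {P Q : DiffOp D} {m n : ℕ} {c d : 𝕜} (hP : HasSymbol P m c)
    (hQ : HasSymbol Q n d) : HasSymbol (P * Q) (m + n) (c * d) := by
  obtain ⟨p, hp, hpd, hpc⟩ := hP
  obtain ⟨q, hq, hqd, hqc⟩ := hQ
  obtain ⟨e, he, h⟩ := exists_polyOp_mul D p q m n hpd
    (fun j hj => by rw [Polynomial.coeff_eq_zero_of_natDegree_lt (by omega), map_zero])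
  have hdq : (coeffDeriv D q).natDegree ≤ n := by
    rw [Polynomial.natDegree_le_iff_coeff_eq_zero]
    intro j hj
    rw [coeff_coeffDeriv, Polynomial.coeff_eq_zero_of_natDegree_lt (by omega), map_zero]
  have h0 : (Polynomial.derivative p * coeffDeriv D q).natDegree ≤ m + n :=
    Polynomial.natDegree_mul_le_of_le ((Polynomial.natDegree_derivative_le p).trans (by omega)) hdq
  have h1 : (Polynomial.derivative p * coeffDeriv D q).coeff (m + n) = 0 := by
    -- For `m = 0` the bound `m - 1` on the degree of `p'` saves nothing, but then `p' = 0`.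
    rcases m with _ | m
    · rw [Polynomial.eq_C_of_natDegree_le_zero hpd]
      simp
    · refine Polynomial.coeff_eq_zero_of_natDegree_lt (lt_of_le_of_lt
        (Polynomial.natDegree_mul_le_of_le (m := m)
          ((Polynomial.natDegree_derivative_le p).trans (by omega)) hdq) (by omega))
  refine ⟨p * q + Polynomial.derivative p * coeffDeriv D q + e, ?_, ?_, ?_⟩
  · rw [← h, hp, hq]; rfl
  · refine Polynomial.natDegree_add_le_of_degree_le (Polynomial.natDegree_add_le_of_degree_le
      (Polynomial.natDegree_mul_le_of_le hpd hqd) h0) ?_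
    rw [Polynomial.natDegree_le_iff_coeff_eq_zero]
    exact fun j hj => he j (by omega)
  · rw [Polynomial.coeff_add, Polynomial.coeff_add, h1, he _ (by omega),
      Polynomial.coeff_mul_add_eq_of_natDegree_le hpd hqd, hpc, hqc, map_mul, add_zero, add_zero]

theorem HasSymbol.smul {P : DiffOp D} {m : ℕ} {c : 𝕜} (hP : HasSymbol P m c) (a : 𝕜) :
    HasSymbol (a • P) m (a * c) := by
  rw [Algebra.smul_def, ← zero_add m]
  exact (hasSymbol_algebraMap a).mul hP

theorem HasSymbol.pow {P : DiffOp D} {m : ℕ} {c : 𝕜} (hP : HasSymbol P m c) (n : ℕ) :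
    HasSymbol (P ^ n) (n * m) (c ^ n) := by
  induction n with
  | zero => simpa using hasSymbol_algebraMap (D := D) 1
  | succ n ih =>
    rw [pow_succ, pow_succ, Nat.succ_mul]
    exact ih.mul hP

/-- Horner's scheme `f = divX f * X + f(0)`: since `n > 0`, the added constant lies strictly below
the top order. -/
theorem HasSymbol.aeval {Q : DiffOp D} {n : ℕ} {c : 𝕜} (hQ : HasSymbol Q n c) (hn : 0 < n)
    (d : ℕ) (f : Polynomial 𝕜) (hf : f.natDegree ≤ d) :
    HasSymbol (Polynomial.aeval Q f) (d * n) (f.coeff d * c ^ d) := by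
  induction d generalizing f with
  | zero =>
    rw [Polynomial.eq_C_of_natDegree_le_zero hf]
    simpa using hasSymbol_algebraMap (D := D) (f.coeff 0)
  | succ d ih =>
    have h := ih f.divX (by rw [Polynomial.natDegree_divX_eq_natDegree_tsub_one]; omega)
    have h1 := (h.mul hQ).add
      ((hasSymbol_algebraMap (f.coeff 0)).of_lt (n := d * n + n) (by omega))
    rw [← Polynomial.divX_mul_X_add f]
    have e1 : (d + 1) * n = d * n + n := by ring
    have e2 : (f.divX * Polynomial.X + Polynomial.C (f.coeff 0)).coeff (d + 1) * c ^ (d + 1) =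
        f.divX.coeff d * c ^ d * c + 0 := by
      simp [pow_succ, mul_assoc]
    rw [e1, e2]
    simpa using h1

theorem hasSymbol_zero (m : ℕ) : HasSymbol (0 : DiffOp D) m 0 :=
  ⟨0, polyOp_zero D, by simp, by simp⟩

theorem IsStandardForm.exists_hasSymbol {P : DiffOp D} (hP : IsStandardForm P) (hP0 : P ≠ 0) :
    ∃ m c, c ≠ 0 ∧ HasSymbol P m c := by
  obtain ⟨p, hp, ⟨c, hc⟩, -⟩ := hP
  refine ⟨p.natDegree, c, ?_, p, hp, le_rfl, hc⟩
  rintro rfl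
  rw [map_zero, Polynomial.leadingCoeff_eq_zero] at hc
  rw [hc, polyOp_zero] at hp
  exact hP0 (Subtype.ext hp.symm)

theorem isAddTorsionFree_of_algebra (𝕜 F : Type*) [Field 𝕜] [CharZero 𝕜] [CommRing F]
    [Algebra 𝕜 F] : IsAddTorsionFree F := by
  let _ : Module ℚ F := Module.compHom F (algebraMap ℚ 𝕜)
  exact IsAddTorsionFree.of_module_rat F

variable [CharZero 𝕜] {z : F}

theorem HasSymbol.unique [Nontrivial F] (hz : D z = 1) {P : DiffOp D} {m : ℕ} {c d : 𝕜} (h : HasSymbol P m c)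
    (h' : HasSymbol P m d) : c = d := by
  have := isAddTorsionFree_of_algebra 𝕜 F
  obtain ⟨p, hp, -, hc⟩ := h
  obtain ⟨q, hq, -, hd⟩ := h'
  rw [polyOp_injective D hz (hp.trans hq.symm), hd] at hc
  exact ((algebraMap 𝕜 F).injective hc).symm

/-- Order and standard form are witnessed by two a priori different polynomials, which injectivity
of `polyOp` identifies. -/
theorem IsStandardForm.hasSymbol (hz : D z = 1) {P : DiffOp D} (hP : IsStandardForm P) {m : ℕ}
    (hm : HasOrder P m) : ∃ c, c ≠ 0 ∧ HasSymbol P m c := by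
  have := isAddTorsionFree_of_algebra 𝕜 F
  obtain ⟨p, hp, ⟨c, hc⟩, -⟩ := hP
  obtain ⟨q, hq0, hq, rfl⟩ := hm
  obtain rfl := polyOp_injective D hz (hp.trans hq.symm)
  refine ⟨c, ?_, p, hp, le_rfl, hc⟩
  rintro rfl
  rw [map_zero, Polynomial.leadingCoeff_eq_zero] at hc
  exact hq0 hc

/-- An operator which commutes with an operator of positive order in standard form is in
standard form. -/
theorem isStandardForm_of_commute (hz : D z = 1) (hker : ∀ f, D f = 0 → ∃ c, f = algebraMap 𝕜 F c)
    {P Q : DiffOp D} (hP : IsStandardForm P) {m : ℕ} (hm : HasOrder P m) (hm0 : 0 < m)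
    (hPQ : P * Q = Q * P) : IsStandardForm Q := by
  have := isAddTorsionFree_of_algebra 𝕜 F
  obtain ⟨p, hp, ⟨c, hc⟩, ⟨c', hc'⟩⟩ := hP
  obtain ⟨p', hp0, hp', rfl⟩ := hm
  obtain rfl := polyOp_injective D hz (hp.trans hp'.symm)
  obtain ⟨q, hq⟩ := Q.2
  have hc0 : c ≠ 0 := by
    rintro rfl
    rw [map_zero, Polynomial.leadingCoeff_eq_zero] at hc
    exact hp0 hc
  set m := p.natDegree with hm
  set k := q.natDegree with hk
  rw [Polynomial.nextCoeff_of_natDegree_pos hm0] at hc'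
  have hDp : ∀ j, m < j + 2 → D (p.coeff j) = 0 := by
    intro j hj
    rcases Nat.lt_or_ge m j with h | h
    · rw [Polynomial.coeff_eq_zero_of_natDegree_lt h, map_zero]
    · rcases Nat.eq_or_lt_of_le h with rfl | h
      · have : p.coeff m = algebraMap 𝕜 F c := hc
        rw [this, Derivation.map_algebraMap]
      · rw [show j = m - 1 by omega, hc', Derivation.map_algebraMap]
  -- the derivative of the symbol of `Q` has degree less than `k - 1`
  have hDq : ∀ j, k < j + 2 → D (q.coeff j) = 0 := by
    by_contra! hcon
    obtain ⟨j, hj, hDj⟩ := hcon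
    -- The topmost nonconstant coefficient of `Q`; by assumption `l ≥ k - 1`.
    set l := (coeffDeriv D q).natDegree with hl
    have hjl : j ≤ l := Polynomial.le_natDegree_of_ne_zero (by simpa using hDj)
    have hl0 : D (q.coeff l) ≠ 0 := by
      rw [← coeff_coeffDeriv, hl]
      change (coeffDeriv D q).leadingCoeff ≠ 0
      rw [Polynomial.leadingCoeff_ne_zero]
      intro h0
      exact hDj (by rw [← coeff_coeffDeriv, h0, Polynomial.coeff_zero])
    obtain ⟨e, he, h1⟩ := exists_polyOp_mul D p q m l le_rfl
      (fun j hj => by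
        rw [← coeff_coeffDeriv, Polynomial.coeff_eq_zero_of_natDegree_lt hj])
    -- Standard form of `P` bounds the degree of `D p` by `m - 2`. For `m = 1` the truncated value
    -- `0` is harmless, as then `D p = 0`.
    obtain ⟨e', he', h2⟩ := exists_polyOp_mul D q p k (m - 2) le_rfl
      (fun j hj => hDp j (by omega))
    have h3 : polyOp D p * polyOp D q = polyOp D q * polyOp D p := by
      rw [hp, hq]; exact congrArg Subtype.val hPQ
    rw [h1, h2] at h3
    -- At this index `p q` cancels against `q p`, and only the top coefficient of `p' * D q`
    -- survives.
    have h4 := congrArg (fun r => Polynomial.coeff r (m - 1 + l)) (polyOp_injective D hz h3)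
    simp only [Polynomial.coeff_add] at h4
    have h5 : e.coeff (m - 1 + l) = 0 := he _ (by omega)
    have h6 : (Polynomial.derivative q * coeffDeriv D p).coeff (m - 1 + l) = 0 ∧
        e'.coeff (m - 1 + l) = 0 := by
      refine ⟨?_, he' _ (by omega)⟩
      rcases Nat.lt_or_ge m 2 with hm2 | hm2
      · have : coeffDeriv D p = 0 := by
          ext j
          rw [coeff_coeffDeriv, hDp j (by omega), Polynomial.coeff_zero]
        rw [this, mul_zero, Polynomial.coeff_zero]
      · have hdp : (coeffDeriv D p).natDegree ≤ m - 2 := by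
          rw [Polynomial.natDegree_le_iff_coeff_eq_zero]
          exact fun j hj => hDp j (by omega)
        exact Polynomial.coeff_eq_zero_of_natDegree_lt (lt_of_le_of_lt
          (Polynomial.natDegree_mul_le_of_le (Polynomial.natDegree_derivative_le q) hdp)
          (by omega))
    have h7 : (Polynomial.derivative p * coeffDeriv D q).coeff (m - 1 + l) =
        m * (algebraMap 𝕜 F c * D (q.coeff l)) := by
      rw [Polynomial.coeff_mul_add_eq_of_natDegree_le (Polynomial.natDegree_derivative_le p) le_rfl,
        Polynomial.coeff_derivative, coeff_coeffDeriv, show m - 1 + 1 = m by omega]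
      have : p.coeff m = algebraMap 𝕜 F c := hc
      rw [this, ← Nat.cast_succ, show (m - 1).succ = m by omega]
      ring
    rw [h5, h6.1, h6.2, h7, mul_comm q p, add_zero, add_zero, add_zero, add_eq_left,
      ← nsmul_eq_mul, ← Algebra.smul_def] at h4
    -- `m` cancels by torsion-freeness and `c` as a nonzero scalar, so zero divisors of `F` do not
    -- interfere.
    have h8 := (nsmul_eq_zero_iff_right hm0.ne').1 h4
    rw [smul_eq_zero_iff_right hc0] at h8
    exact hl0 h8
  refine ⟨q, hq, hker _ (hDq _ (by omega)), ?_⟩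
  rcases Nat.eq_zero_or_pos k with h0 | h0
  · exact ⟨0, by rw [Polynomial.nextCoeff, if_pos h0, map_zero]⟩
  · rw [Polynomial.nextCoeff_of_natDegree_pos h0]
    exact hker _ (hDq _ (by omega))

end Centralizer

/-! ### Finite codimension and commutativity of the centraliser -/

section FiniteCodimension

variable {𝕜 F : Type*} [Field 𝕜] [CommRing F] [Algebra 𝕜 F]
  {D : Derivation 𝕜 F F}

/-- If all elements of `C` have constant symbols, and if the subalgebra `A` has elements of all
sufficiently high orders, then it has finite codimension in `C`. -/
theorem finiteCodimIn_of_hasSymbol {A C : Subalgebra 𝕜 (DiffOp D)} (hAC : A ≤ C) (N : ℕ)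
    (hA : ∀ k, N ≤ k → ∃ P ∈ A, ∃ c : 𝕜, c ≠ 0 ∧ HasSymbol P k c)
    (hC : ∀ P ∈ C, P ≠ 0 → ∃ k c, c ≠ 0 ∧ HasSymbol P k c)
    (hlow : ∀ P ∈ C, ∀ k, HasSymbol P k (0 : 𝕜) → P ≠ 0 → ∃ j < k, ∃ c, c ≠ 0 ∧ HasSymbol P j c) :
    FiniteCodimIn A C := by
  -- below any order, `C` is contained in `A` up to a finite set
  have key : ∀ n : ℕ, ∃ S : Set (DiffOp D), S.Finite ∧ S ⊆ C ∧
      ∀ P ∈ C, ∀ k < n, ∀ c : 𝕜, HasSymbol P k c →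
        P ∈ Subalgebra.toSubmodule A ⊔ Submodule.span 𝕜 S := by
    intro n
    induction n with
    | zero => exact ⟨∅, Set.finite_empty, Set.empty_subset _, fun P _ k hk => by omega⟩
    | succ n ih =>
      obtain ⟨S, hS, hSC, h⟩ := ih
      -- One new generator at order `n` is enough: any other element is brought to lower order by
      -- subtracting a scalar multiple of it.
      by_cases hn : ∃ R ∈ C, ∃ c : 𝕜, c ≠ 0 ∧ HasSymbol R n c
      · obtain ⟨R, hR, d, hd, hRd⟩ := hn
        refine ⟨insert R S, hS.insert R, Set.insert_subset hR hSC, fun P hP k hk c hc => ?_⟩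
        have hle : Subalgebra.toSubmodule A ⊔ Submodule.span 𝕜 S ≤
            Subalgebra.toSubmodule A ⊔ Submodule.span 𝕜 (insert R S) :=
          sup_le_sup_left (Submodule.span_mono (Set.subset_insert R S)) _
        rcases Nat.lt_or_ge k n with hkn | hkn
        · exact hle (h P hP k hkn c hc)
        · obtain rfl : k = n := by omega
          have hRS : R ∈ Subalgebra.toSubmodule A ⊔ Submodule.span 𝕜 (insert R S) :=
            Submodule.mem_sup_right (Submodule.subset_span (Set.mem_insert R S))
          have h1 : HasSymbol (P + (-(c / d)) • R) k 0 := by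
            have := hc.add (hRd.smul (-(c / d)))
            rwa [neg_mul, div_mul_cancel₀ _ hd, add_neg_cancel] at this
          have h2 : P + (-(c / d)) • R ∈ C := C.add_mem hP (C.smul_mem hR _)
          have h3 : P + (-(c / d)) • R ∈
              Subalgebra.toSubmodule A ⊔ Submodule.span 𝕜 (insert R S) := by
            by_cases h0 : P + (-(c / d)) • R = 0
            · rw [h0]; exact Submodule.zero_mem _
            · obtain ⟨j, hj, c', -, hc'⟩ := hlow _ h2 k h1 h0
              exact hle (h _ h2 j hj c' hc')
          have := Submodule.sub_mem _ h3 (Submodule.smul_mem _ (-(c / d)) hRS)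
          rwa [add_sub_cancel_right] at this
      · refine ⟨S, hS, hSC, fun P hP k hk c hc => ?_⟩
        rcases Nat.lt_or_ge k n with hkn | hkn
        · exact h P hP k hkn c hc
        · obtain rfl : k = n := by omega
          by_cases hP0 : P = 0
          · rw [hP0]; exact Submodule.zero_mem _
          by_cases hc0 : c = 0
          · subst hc0
            obtain ⟨j, hj, c', -, hc'⟩ := hlow _ hP k hc hP0
            exact h P hP j hj c' hc'
          · exact absurd ⟨P, hP, c, hc0, hc⟩ hn
  obtain ⟨S, hS, hSC, h⟩ := key N
  -- From order `N` on, the leading term is removed by an element of `A`, so `S` need not grow.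
  have hall : ∀ k : ℕ, ∀ P ∈ C, ∀ c : 𝕜, HasSymbol P k c →
      P ∈ Subalgebra.toSubmodule A ⊔ Submodule.span 𝕜 S := by
    intro k
    induction k using Nat.strong_induction_on with
    | _ k ih =>
      intro P hP c hc
      rcases Nat.lt_or_ge k N with hk | hk
      · exact h P hP k hk c hc
      · obtain ⟨R, hR, d, hd, hRd⟩ := hA k hk
        have h1 : HasSymbol (P + (-(c / d)) • R) k 0 := by
          have := hc.add (hRd.smul (-(c / d)))
          rwa [neg_mul, div_mul_cancel₀ _ hd, add_neg_cancel] at this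
        have h2 : P + (-(c / d)) • R ∈ C := C.add_mem hP (C.smul_mem (hAC hR) _)
        have h3 : P + (-(c / d)) • R ∈ Subalgebra.toSubmodule A ⊔ Submodule.span 𝕜 S := by
          by_cases h0 : P + (-(c / d)) • R = 0
          · rw [h0]; exact Submodule.zero_mem _
          · obtain ⟨j, hj, c', -, hc'⟩ := hlow _ h2 k h1 h0
            exact ih j hj _ h2 c' hc'
        have := Submodule.sub_mem _ h3
          (Submodule.smul_mem _ (-(c / d)) (Submodule.mem_sup_left (show R ∈ _ from hR)))
        rwa [add_sub_cancel_right] at this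
  refine ⟨hAC, ?_⟩
  have hfin : Module.Finite 𝕜 (Submodule.span 𝕜 S) := Module.Finite.span_of_finite 𝕜 hS
  have hle : Submodule.span 𝕜 S ≤ Subalgebra.toSubmodule C := Submodule.span_le.2 hSC
  refine Module.Finite.of_surjective (((Subalgebra.toSubmodule A).submoduleOf
    (Subalgebra.toSubmodule C)).mkQ ∘ₗ Submodule.inclusion hle) fun x => ?_
  obtain ⟨⟨P, hP⟩, rfl⟩ := Submodule.mkQ_surjective _ x
  have hPs : P ∈ Subalgebra.toSubmodule A ⊔ Submodule.span 𝕜 S := by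
    by_cases hP0 : P = 0
    · rw [hP0]; exact Submodule.zero_mem _
    · obtain ⟨k, c, -, hc⟩ := hC P hP hP0
      exact hall k P hP c hc
  obtain ⟨a, ha, s, hs, rfl⟩ := Submodule.mem_sup.1 hPs
  refine ⟨⟨s, hs⟩, ?_⟩
  rw [LinearMap.comp_apply, ← sub_eq_zero, ← map_sub, Submodule.mkQ_apply,
    Submodule.Quotient.mk_eq_zero]
  show s - (a + s) ∈ Subalgebra.toSubmodule A
  rw [sub_add_cancel_right]
  exact Submodule.neg_mem _ ha

/-- A subalgebra `C` which centralises a subalgebra `A` of finite codimension is commutative if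
multiplication with the nonzero polynomials in some `Q ∈ A` is injective on `C`. -/
theorem FiniteCodimIn.commute {𝕜 R : Type*} [Field 𝕜] [Ring R] [Algebra 𝕜 R]
    {A C : Subalgebra 𝕜 R} (h : FiniteCodimIn A C) (hAC : ∀ a ∈ A, ∀ x ∈ C, a * x = x * a)
    {Q : R} (hQ : Q ∈ A)
    (hinj : ∀ f : Polynomial 𝕜, f ≠ 0 → ∀ x ∈ C, Polynomial.aeval Q f * x = 0 → x = 0) :
    ∀ x ∈ C, ∀ y ∈ C, x * y = y * x := by
  intro x hx y hy
  have hfin := h.2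
  have hQf : ∀ f : Polynomial 𝕜, Polynomial.aeval Q f ∈ A := fun f =>
    Algebra.adjoin_le (Set.singleton_subset_iff.2 hQ) (Polynomial.aeval_mem_adjoin_singleton 𝕜 Q)
  let φ : Polynomial 𝕜 →ₗ[𝕜] ↥(Subalgebra.toSubmodule C) :=
    LinearMap.codRestrict (Subalgebra.toSubmodule C)
      (LinearMap.mulRight 𝕜 x ∘ₗ (Polynomial.aeval Q).toLinearMap)
      (fun f => C.mul_mem (h.1 (hQf f)) hx)
  let ψ := ((Subalgebra.toSubmodule A).submoduleOf (Subalgebra.toSubmodule C)).mkQ ∘ₗ φ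
  -- `𝕜[X]` is infinite-dimensional and `C / A` is not, so some `f ≠ 0` has `f(Q) x ∈ A`.
  have hψ : ¬ Function.Injective ψ := fun hi =>
    Polynomial.not_finite (R := 𝕜) (Module.Finite.of_injective ψ hi)
  rw [← LinearMap.ker_eq_bot, Submodule.eq_bot_iff] at hψ
  push Not at hψ
  obtain ⟨f, hf, hf0⟩ := hψ
  have hfx : Polynomial.aeval Q f * x ∈ A := by
    rw [LinearMap.mem_ker, LinearMap.comp_apply, Submodule.mkQ_apply,
      Submodule.Quotient.mk_eq_zero] at hf
    exact hf
  refine sub_eq_zero.1 (hinj f hf0 _ (C.sub_mem (C.mul_mem hx hy) (C.mul_mem hy hx)) ?_)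
  -- `f(Q) x y = y f(Q) x = f(Q) y x`: both `f(Q) x` and `f(Q)` lie in `A`, hence commute with `y`.
  rw [mul_sub, ← mul_assoc, hAC _ hfx y hy, ← mul_assoc _ y, hAC _ (hQf f) y hy, mul_assoc y,
    sub_self]

/-- The centraliser of an algebra of rank one, over any differential algebra which has a
coordinate, and which has only the obvious constants. -/
theorem isRankOne_centralizer [CharZero 𝕜] [Nontrivial F] {z : F} (hz : D z = 1)
    (hker : ∀ f, D f = 0 → ∃ c, f = algebraMap 𝕜 F c) {A : Subalgebra 𝕜 (DiffOp D)}
    (hA : IsRankOne A) :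
    IsRankOne (Subalgebra.centralizer 𝕜 (A : Set (DiffOp D))) ∧
      FiniteCodimIn A (Subalgebra.centralizer 𝕜 (A : Set (DiffOp D))) := by
  set C := Subalgebra.centralizer 𝕜 (A : Set (DiffOp D)) with hCdef
  have hcomm : ∀ a ∈ A, ∀ x ∈ C, a * x = x * a := fun a ha x hx =>
    Subalgebra.mem_centralizer_iff 𝕜 |>.1 hx a ha
  have hAC : A ≤ C := fun x hx => (Subalgebra.mem_centralizer_iff 𝕜).2
    fun a ha => hA.commutative a ha x hx
  obtain ⟨P, hP, Q, hQ, m, n, hPm, hQn, hmn⟩ := hA.coprime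
  -- Coprimality excludes two orders `0`; if `m = 0`, then `n = 1`.
  have hpos : ∃ R ∈ A, ∃ k, 0 < k ∧ HasOrder R k := by
    rcases Nat.eq_zero_or_pos m with rfl | hm
    · exact ⟨Q, hQ, n, by rw [Nat.coprime_zero_left] at hmn; omega, hQn⟩
    · exact ⟨P, hP, m, hm, hPm⟩
  obtain ⟨R, hR, k, hk, hRk⟩ := hpos
  have hstd : ∀ x ∈ C, IsStandardForm x := fun x hx =>
    isStandardForm_of_commute hz hker (hA.standardForm R hR) hRk hk (hcomm R hR x hx)
  have hsym : ∀ x ∈ C, x ≠ 0 → ∃ k c, c ≠ 0 ∧ HasSymbol x k c := fun x hx hx0 =>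
    (hstd x hx).exists_hasSymbol hx0
  have hlow : ∀ x ∈ C, ∀ k, HasSymbol x k (0 : 𝕜) → x ≠ 0 →
      ∃ j < k, ∃ c, c ≠ 0 ∧ HasSymbol x j c := by
    intro x hx k h0 hx0
    obtain ⟨j, c, hc0, hc⟩ := hsym x hx hx0
    refine ⟨j, ?_, c, hc0, hc⟩
    by_contra! hkj
    rcases hkj.eq_or_lt with rfl | hkj
    · exact hc0 (hc.unique hz h0)
    · exact hc0 (hc.unique hz (h0.of_lt hkj))
  have hcod : FiniteCodimIn A C := by
    obtain ⟨p, hp0, hp⟩ := (hA.standardForm P hP).hasSymbol hz hPm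
    obtain ⟨q, hq0, hq⟩ := (hA.standardForm Q hQ).hasSymbol hz hQn
    -- The Frobenius bound: every `k ≥ (m - 1)(n - 1)` has the form `a m + b n`.
    refine finiteCodimIn_of_hasSymbol hAC (m.pred * n.pred) (fun k hk => ?_) hsym hlow
    obtain ⟨a, b, rfl⟩ := Nat.exists_add_mul_eq_of_gcd_dvd_of_mul_pred_le m n k
      (by rw [hmn.gcd_eq_one]; exact one_dvd k) hk
    exact ⟨P ^ a * Q ^ b, A.mul_mem (A.pow_mem hP a) (A.pow_mem hQ b), p ^ a * q ^ b,
      mul_ne_zero (pow_ne_zero a hp0) (pow_ne_zero b hq0), (hp.pow a).mul (hq.pow b)⟩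
  refine ⟨⟨?_, hstd, P, hAC hP, Q, hAC hQ, m, n, hPm, hQn, hmn⟩, hcod⟩
  -- The leading coefficient of `f(R) x` is a product of nonzero scalars: that of `f`, a power of
  -- that of `R`, and that of `x`.
  refine hcod.commute hcomm hR fun f hf x hx hfx => ?_
  by_contra hx0
  obtain ⟨c, hc0, hc⟩ := (hA.standardForm R hR).hasSymbol hz hRk
  obtain ⟨j, d, hd0, hd⟩ := hsym x hx hx0
  have h1 := (hc.aeval hk f.natDegree f le_rfl).mul hd
  rw [hfx] at h1
  have h2 := h1.unique hz (hasSymbol_zero _)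
  rw [mul_eq_zero, mul_eq_zero] at h2
  rcases h2 with (h2 | h2) | h2
  · exact hf (Polynomial.leadingCoeff_eq_zero.1 h2)
  · exact pow_ne_zero _ hc0 h2
  · exact hd0 h2

end FiniteCodimension

/-! ### Coordinates and constants in the function algebras -/

section Coordinate

variable {𝕜 : Type*} [NontriviallyNormedField 𝕜] {I : Set 𝕜} (F : Subalgebra 𝕜 (I → 𝕜))
  (hu : UniqueDiffOn 𝕜 I) (hd : ∀ f ∈ F, DifferentiableOn 𝕜 (extZero f) I)
  (hF : ∀ f ∈ F, (fun z : I => derivWithin (extZero f) I z) ∈ F)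

theorem nontrivial_coeffFun (hI : I.Nonempty) : Nontrivial (CoeffFun F) :=
  have : Nonempty I := hI.to_subtype
  inferInstanceAs (Nontrivial F)

theorem derivOn_coordinate (hz : (fun x : I => (x : 𝕜)) ∈ F) :
    derivOn F hu hd hF ⟨fun x => x, hz⟩ = 1 := by
  refine Subtype.ext (funext fun x => ?_)
  change derivWithin (extZero fun x : I => (x : 𝕜)) I x = 1
  rw [derivWithin_congr (f := id) (fun y hy => extZero_apply _ hy) (extZero_apply _ x.2),
    derivWithin_id _ _ (hu x x.2)]

theorem hasDerivWithinAt_of_derivOn_eq_zero (f : CoeffFun F) (hf : derivOn F hu hd hF f = 0)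
    (x : 𝕜) (hx : x ∈ I) : HasDerivWithinAt (extZero f.1) 0 I x := by
  have h : derivWithin (extZero f.1) I x = 0 := congrFun (congrArg Subtype.val hf) ⟨x, hx⟩
  rw [← h]
  exact (hd f.1 f.2 x hx).hasDerivWithinAt

theorem exists_eq_algebraMap_coeffFun (f : CoeffFun F) (hI : I.Nonempty)
    (hf : ∀ x ∈ I, ∀ y ∈ I, extZero f.1 x = extZero f.1 y) :
    ∃ c, f = algebraMap 𝕜 (CoeffFun F) c := by
  obtain ⟨x, hx⟩ := hI
  refine ⟨extZero f.1 x, Subtype.ext (funext fun y => ?_)⟩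
  change f.1 y = extZero f.1 x
  rw [hf x hx y y.2, extZero_apply _ y.2]

end Coordinate

/-- A function on a smooth curve whose derivative along the curve vanishes is locally constant. -/
theorem IsSmoothCurve.eventually_eq {I : Set ℂ} (hI : IsSmoothCurve I) {f : ℂ → ℂ}
    (hf : ∀ w ∈ I, HasDerivWithinAt f 0 I w) {z : ℂ} (hz : z ∈ I) :
    ∀ᶠ w in nhdsWithin z I, f w = f z := by
  obtain ⟨Φ, hzΦ, h1, h2, h3⟩ := hI z hz
  have hΦre : ∀ w ∈ I ∩ Φ.source, (((Φ w).re : ℝ) : ℂ) = Φ w := fun w hw =>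
    Complex.ext (by simp) (by simp [(h3 w hw.2).1 hw.1])
  set V : Set ℝ := {t | (t : ℂ) ∈ Φ.target} with hV
  have hVo : IsOpen V := Φ.open_target.preimage Complex.continuous_ofReal
  have hreV : ∀ w ∈ I ∩ Φ.source, (Φ w).re ∈ V := fun w hw => by
    show (((Φ w).re : ℝ) : ℂ) ∈ Φ.target
    rw [hΦre w hw]
    exact Φ.map_source hw.2
  set γ : ℝ → ℂ := fun t => Φ.symm t with hγ
  have hγI : ∀ t ∈ V, γ t ∈ I := fun t ht =>
    (h3 _ (Φ.map_target ht)).2 (by rw [Φ.right_inv ht, Complex.ofReal_im])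
  have hγre : ∀ w ∈ I ∩ Φ.source, γ (Φ w).re = w := fun w hw => by
    show Φ.symm (((Φ w).re : ℝ) : ℂ) = w
    rw [hΦre w hw]
    exact Φ.left_inv hw.2
  have hγs : ContDiffOn ℝ ∞ γ V :=
    h2.comp Complex.ofRealCLM.contDiff.contDiffOn (fun t ht => ht)
  have hγd : ∀ t ∈ V, HasDerivAt γ (deriv γ t) t := fun t ht =>
    ((hγs.contDiffAt (hVo.mem_nhds ht)).differentiableAt (by simp)).hasDerivAt
  -- The chain rule with a derivative taken only within `I` applies because `γ` maps a neighbourhood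
  -- of `t` into `I`.
  have hfγ : ∀ t ∈ V, HasDerivAt (f ∘ γ) 0 t := fun t ht => by
    have hmaps : ∀ᶠ s in nhds t, γ s ∈ I :=
      Filter.mem_of_superset (hVo.mem_nhds ht) hγI
    simpa using ((hf (γ t) (hγI t ht)).hasFDerivWithinAt.restrictScalars ℝ).comp_hasDerivAt t
      (hγd t ht) hmaps
  -- `V` may be disconnected, so constancy is only claimed on an interval around the parameter of
  -- `z`.
  obtain ⟨ε, hε, hball⟩ := Metric.isOpen_iff.1 hVo _ (hreV z ⟨hz, hzΦ⟩)
  have hconst : ∀ t ∈ Metric.ball (Φ z).re ε, (f ∘ γ) t = (f ∘ γ) (Φ z).re := fun t ht =>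
    Metric.isOpen_ball.is_const_of_deriv_eq_zero (convex_ball _ _).isPreconnected
      (fun s hs => (hfγ s (hball hs)).differentiableAt.differentiableWithinAt)
      (fun s hs => (hfγ s (hball hs)).deriv) ht (Metric.mem_ball_self hε)
  have hcont : ContinuousAt (fun w => (Φ w).re) z :=
    Complex.continuous_re.continuousAt.comp (Φ.continuousAt hzΦ)
  filter_upwards [self_mem_nhdsWithin,
    nhdsWithin_le_nhds (Φ.open_source.mem_nhds hzΦ),
    nhdsWithin_le_nhds (hcont.preimage_mem_nhds (Metric.ball_mem_nhds _ hε))] with w hw hwΦ hwε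
  have h := hconst _ hwε
  rwa [Function.comp_apply, Function.comp_apply, hγre w ⟨hw, hwΦ⟩, hγre z ⟨hz, hzΦ⟩] at h

theorem IsSmoothCurve.eq_of_hasDerivWithinAt_zero {I : Set ℂ} (hI : IsSmoothCurve I)
    (hc : PreconnectedSpace I) {f : ℂ → ℂ} (hf : ∀ w ∈ I, HasDerivWithinAt f 0 I w) :
    ∀ x ∈ I, ∀ y ∈ I, f x = f y := by
  intro x hx y hy
  have hloc : IsLocallyConstant fun w : I => f w := by
    rw [IsLocallyConstant.iff_eventually_eq]
    intro w
    have := hI.eventually_eq hf w.2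
    rw [nhdsWithin_eq_map_subtype_coe w.2] at this
    exact Filter.eventually_map.1 this
  exact hloc.apply_eq_of_preconnectedSpace ⟨x, hx⟩ ⟨y, hy⟩


theorem mainTheorem7 :
    -- an open interval, with real smooth coefficients
    (∀ (I : Set ℝ) (hI : IsOpen I), I.Nonempty → I.OrdConnected →
      ∀ A : Subalgebra ℝ (DiffOp (derivReal hI)), IsRankOne A →
        IsRankOne (Subalgebra.centralizer ℝ (A : Set (DiffOp (derivReal hI)))) ∧
        FiniteCodimIn A (Subalgebra.centralizer ℝ (A : Set (DiffOp (derivReal hI))))) ∧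
    -- a curve in the complex plane, with complex smooth coefficients
    (∀ (I : Set ℂ) (hI : IsSmoothCurve I), ¬ IsCompact I → SimplyConnectedSpace I →
      ∀ A : Subalgebra ℂ (DiffOp (derivCurve hI)), IsRankOne A →
        IsRankOne (Subalgebra.centralizer ℂ (A : Set (DiffOp (derivCurve hI)))) ∧
        FiniteCodimIn A (Subalgebra.centralizer ℂ (A : Set (DiffOp (derivCurve hI))))) ∧
    -- a domain in the complex plane, with holomorphic coefficients
    (∀ (I : Set ℂ) (hI : IsOpen I), IsConnected I →
      ∀ A : Subalgebra ℂ (DiffOp (derivHol hI)), IsRankOne A →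
        IsRankOne (Subalgebra.centralizer ℂ (A : Set (DiffOp (derivHol hI)))) ∧
        FiniteCodimIn A (Subalgebra.centralizer ℂ (A : Set (DiffOp (derivHol hI))))) := by

  -- In each case the inclusion of `I` is the coordinate, and connectedness of `I` makes functions
  -- with zero derivative constant; for curves it comes from simple connectedness.
  refine ⟨fun I hI hne hI' A hA => ?_, fun I hI _ hI' A hA => ?_, fun I hI hI' A hA => ?_⟩
  · have := nontrivial_coeffFun (realSmoothFun I) hne
    have hz : (fun x : I => (x : ℝ)) ∈ realSmoothFun I :=
      contDiffOn_id.congr fun x hx => extZero_apply _ hx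
    refine isRankOne_centralizer (derivOn_coordinate _ _ _ _ hz) (fun f hf => ?_) hA
    have hd := hasDerivWithinAt_of_derivOn_eq_zero _ _ _ _ f hf
    exact exists_eq_algebraMap_coeffFun _ f hne fun x hx y hy =>
      hI.is_const_of_deriv_eq_zero hI'.isPreconnected
        (fun w hw => (hd w hw).differentiableWithinAt)
        (fun w hw => ((hd w hw).hasDerivAt (hI.mem_nhds hw)).deriv) hx hy
  · have hne : I.Nonempty := Set.nonempty_coe_sort.1 (inferInstance : Nonempty I)
    have := nontrivial_coeffFun (complexSmoothFun I) hne
    have hz : (fun x : I => (x : ℂ)) ∈ complexSmoothFun I :=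
      contDiffOn_id.congr fun x hx => extZero_apply _ hx
    refine isRankOne_centralizer (derivOn_coordinate _ _ _ _ hz) (fun f hf => ?_) hA
    exact exists_eq_algebraMap_coeffFun _ f hne
      (hI.eq_of_hasDerivWithinAt_zero inferInstance
        (hasDerivWithinAt_of_derivOn_eq_zero _ _ _ _ f hf))
  · have := nontrivial_coeffFun (holFun I) hI'.nonempty
    have hz : (fun x : I => (x : ℂ)) ∈ holFun I :=
      differentiableOn_id.congr fun x hx => extZero_apply _ hx
    refine isRankOne_centralizer (derivOn_coordinate _ _ _ _ hz) (fun f hf => ?_) hA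
    have hd := hasDerivWithinAt_of_derivOn_eq_zero _ _ _ _ f hf
    exact exists_eq_algebraMap_coeffFun _ f hI'.nonempty fun x hx y hy =>
      hI.is_const_of_deriv_eq_zero hI'.isPreconnected
        (fun w hw => (hd w hw).differentiableWithinAt)
        (fun w hw => ((hd w hw).hasDerivAt (hI.mem_nhds hw)).deriv) hx hy
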